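/- \textbf{Conventions.} Let $X$ be a finite regular CW complex: a Hausdorff CW complex with finitely many cells such that, for each cell $e$ of dimension $n$, the pair $(\bar e,\partial e)$ is homeomorphic to $(B^n,S^{n-1})$ and the boundary $\partial e$ is a union of (open) cells of dimension less than $n$. Let $\mathcal F(X)$ be the poset of its closed cells (which are non-empty), ordered by inclusion, and let $\Delta(\mathcal F(X))$ be its order complex, the simplicial complex whose simplices are the non-empty finite chains. Points of the geometric realisation $|\Delta(\mathcal F(X))|$ are written in barycentric coordinates. Choose for every cell $e$ a homeomorphism of pairs $\varphi_e:(B^n,S^{n-1})\to(\bar e,\partial e)$. The barycentre of $e$ is $b_e=\varphi_e(0)$. The barycentric subdivision of $X$ (with respect to these charts) is the smallest collection of simplices (vertex set, carrier) in $X$ such that every $(\{b_e\},\{b_e\})$ belongs to it and, whenever $(V,\tau)$ belongs to it and $\tau\subseteq\partial e$, so does its join with $b_e$, the simplex with vertex set $V\cup\{b_e\}$ and carrier $\{\varphi_e(ry): 0\le r\le 1,\ y\in S^{n-1},\ \varphi_e(y)\in\tau\}$. \textbf{Proposition (Combinatorial reconstruction).} (1) Let $X$ be a finite regular CW complex. For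 every choice of charts $(\varphi_e)$ there is exactly one homeomorphism $\Phi:|\Delta(\mathcal F(X))|\to X$ which sends the vertex $\bar e$ to $b_e$ for every cell $e$, and satisfies $\Phi(ru+(1-r)\bar e)=\varphi_e(ry)$ whenever $0\le r\le 1$, $u\in|\Delta(\mathcal F(X))|$ is supported on closed cells properly contained in $\bar e$, and $y\in S^{n-1}$ with $\varphi_e(y)=\Phi(u)$. This $\Phi$ identifies the order complex with the barycentric subdivision of $X$: the simplices of the latter are exactly the pairs $(\Phi(s),\Phi(|s|))$, where $s$ runs through the non-empty chains of $\mathcal F(X)$ and $|s|$ is the closed simplex spanned by $s$. Moreover, $\Phi$ maps $|\Delta(\{\rho\in\mathcal F(X):\rho\subseteq\sigma\})|$ onto $\sigma$ for every closed cell $\sigma$. (2) In particular, $|\Delta(\mathcal F(X))|$ is homeomorphic to $X$. (3) Let $K$ be a finite simplicial complex in a Hausdorff real topological vector space, with polyhedron $|K|$, and let $\mathcal F(K)$ be the poset of its non-empty simplices, ordered by inclusion. Then the usual barycentric subdivision map $\sum_\sigma t_\sigma\,\sigma\mapsto\sum_\sigma t_\sigma\,\hat\sigma$, where $\hat\sigma$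 is the centroid of the vertices of $\sigma$, is a homeomorphism $|\Delta(\mathcal F(K))|\to|K|$. (4) Consequently the face poset determines the polyhedron: if $K$ and $L$ are finite simplicial complexes as in (3) and $\mathcal F(K)\cong\mathcal F(L)$ as posets, then $|K|$ and $|L|$ are homeomorphic. -/

import Mathlib

open Set Metric Topology

namespace FaceReconstruction

/-! ### Order complexes and geometric realisations -/

/-- The closed simplex `|s|` spanned by a finite vertex set `s`, in barycentric coordinates. -/
def closedSimplex {ι : Type*} (s : Finset ι) : Set (ι → ℝ) :=
  {t | (∀ v, 0 ≤ t v) ∧ (∀ v, v ∉ s → t v = 0) ∧ ∑ v ∈ s, t v = 1}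

/-- The geometric realisation of a simplicial complex with finitely many vertices: the union of
its closed simplices in `ℝ^ι`, with the subspace topology. -/
def realization {ι : Type*} [Finite ι] (K : AbstractSimplicialComplex ι) : Set (ι → ℝ) :=
  ⋃ s ∈ K.faces, closedSimplex s

/-- The order complex of a poset: its simplices are the non-empty finite chains. -/
def orderComplex (P : Type*) [PartialOrder P] : AbstractSimplicialComplex P where
  faces := {s | s.Nonempty ∧ IsChain (· ≤ ·) (s : Set P)}
  isRelLowerSet_faces := fun _ hs =>
    ⟨hs.1, fun _ hts ht => ⟨ht, hs.2.mono (Finset.coe_subset.2 hts)⟩⟩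
  singleton_mem := fun v => ⟨Finset.singleton_nonempty v, by simp⟩

open Classical in
/-- The vertex of `|Δ(P)|` given by an element of `P`. -/
noncomputable def vertex {P : Type*} [PartialOrder P] [Finite P] (p : P) :
    realization (orderComplex P) :=
  ⟨Pi.single p 1, by
    refine mem_biUnion ((orderComplex P).singleton_mem p) ⟨fun v => ?_, fun v hv => ?_, ?_⟩
    · by_cases h : v = p
      · subst h; simp
      · simp [h]
    · simp_all
    · simp⟩

/-! ### Regular CW complexes and their face posets -/

section CW

variable {X : Type*} [TopologicalSpace X] {C : Set X} [CWComplex C]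

/-- `f` restricts to a homeomorphism of the closed unit ball onto the closed cell `i` which
carries the unit sphere onto the boundary of the cell. (In a Hausdorff space a continuous
injection of the compact ball is a homeomorphism onto its image. The ball of `Fin n → ℝ` is the
one of the maximum norm, as in Mathlib's CW complexes.) -/
structure IsCellChart {n : ℕ} (i : RelCWComplex.cell C n) (f : (Fin n → ℝ) → X) : Prop where
  continuousOn : ContinuousOn f (closedBall 0 1)
  injOn : InjOn f (closedBall 0 1)
  image_closedBall : f '' closedBall 0 1 = RelCWComplex.closedCell n i
  image_sphere : f '' sphere 0 1 = RelCWComplex.cellFrontier n i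

variable (C) in
/-- A CW complex is regular if every closed cell is a closed ball, with the boundary of the cell
as bounding sphere, and this boundary is a union of lower-dimensional cells. -/
structure IsRegularCW : Prop where
  exists_chart : ∀ (n : ℕ) (i : RelCWComplex.cell C n), ∃ f, IsCellChart i f
  frontier_eq : ∀ (n : ℕ) (i : RelCWComplex.cell C n), ∃ I : Set (Σ m, RelCWComplex.cell C m),
    (∀ p ∈ I, p.1 < n) ∧
      RelCWComplex.cellFrontier n i = ⋃ p ∈ I, RelCWComplex.openCell p.1 p.2

variable (C) in
/-- The face poset: the closed cells (which are never empty), ordered by inclusion. -/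
abbrev FacePoset : Type _ :=
  {σ : Set X // ∃ (n : ℕ) (i : RelCWComplex.cell C n), RelCWComplex.closedCell n i = σ}

/-- A closed cell, as an element of the face poset. -/
def face {n : ℕ} (i : RelCWComplex.cell C n) : FacePoset C :=
  ⟨RelCWComplex.closedCell n i, n, i, rfl⟩

instance [RelCWComplex.Finite C] : Finite (FacePoset C) := by
  have : Finite (Σ n, RelCWComplex.cell C n) :=
    RelCWComplex.finite_iff_finite_cells.1 inferInstance
  refine Finite.of_surjective
    (fun p : Σ n, RelCWComplex.cell C n => (face p.2 : FacePoset C)) ?_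
  rintro ⟨_, n, i, rfl⟩
  exact ⟨⟨n, i⟩, rfl⟩

/-! ### The barycentric subdivision of a regular CW complex

Fix a chart `φ n i` of every cell, as in `IsCellChart`. The barycentre of the cell is the image
of the centre of the ball, and each cell is the cone over its boundary, with the barycentre as
apex, by means of the radii of the ball. -/

/-- The cone over a subset `τ` of the boundary of a cell with chart `f`. -/
def cellCone {n : ℕ} (f : (Fin n → ℝ) → X) (τ : Set X) : Set X :=
  {x | ∃ y ∈ sphere (0 : Fin n → ℝ) 1, f y ∈ τ ∧ ∃ r ∈ Icc (0 : ℝ) 1, x = f (r • y)}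

/-- `IsBarycentricSimplex φ V τ`: the set `τ` is a closed simplex, with vertex set `V`, of the
barycentric subdivision. This subdivision is built cell by cell: every barycentre is a vertex,
and each simplex which lies in the boundary of a cell is joined to the barycentre of the cell. -/
inductive IsBarycentricSimplex (φ : ∀ n : ℕ, RelCWComplex.cell C n → (Fin n → ℝ) → X) :
    Set X → Set X → Prop
  | barycentre {n : ℕ} (i : RelCWComplex.cell C n) :
      IsBarycentricSimplex φ {φ n i 0} {φ n i 0}
  | cone {n : ℕ} (i : RelCWComplex.cell C n) {V τ : Set X} :
      IsBarycentricSimplex φ V τ → τ ⊆ RelCWComplex.cellFrontier n i →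
        IsBarycentricSimplex φ (insert (φ n i 0) V) (cellCone (φ n i) τ)

/-- `Φ` is the barycentric parametrisation with respect to the charts `φ`: it sends the vertex
given by a cell to the barycentre of this cell, and, if `u` is supported on proper faces of a cell
`i`, it sends the segment from the vertex `i` to `u` to the radius of the cell which ends in
`Φ u`. -/
structure IsBarycentricParametrization [RelCWComplex.Finite C]
    (φ : ∀ n : ℕ, RelCWComplex.cell C n → (Fin n → ℝ) → X)
    (Φ : realization (orderComplex (FacePoset C)) → X) : Prop where
  map_vertex : ∀ (n : ℕ) (i : RelCWComplex.cell C n), Φ (vertex (face i)) = φ n i 0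
  map_segment : ∀ (n : ℕ) (i : RelCWComplex.cell C n)
    (u t : realization (orderComplex (FacePoset C))),
    (∀ ρ, u.1 ρ ≠ 0 → ρ < face i) →
    ∀ r ∈ Icc (0 : ℝ) 1, t.1 = r • u.1 + (1 - r) • (vertex (face i)).1 →
    ∀ y ∈ sphere (0 : Fin n → ℝ) 1, φ n i y = Φ u → Φ t = φ n i (r • y)

end CW

end FaceReconstruction

open FaceReconstruction

namespace FaceReconstruction

/-! For regular CW complexes, two recursive descriptions match. A point of the order complex that is
not a vertex is uniquely `r • u + (1 - r) • p`, with `p` the largest element of its support, `0 < r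
< 1`, and `u` supported strictly below `p`. A point of `C` lies in exactly one open cell and, unless
it is the barycentre, is uniquely `φ (r • y)` with `y` on the sphere and `0 < r < 1`. Regularity
says that the frontier of a cell is made of smaller closed cells, so `u` and `φ y` can be matched
recursively.

Instead of gluing a map, the recursion generates a relation, `BarycentricGraph`. Induction over
faces shows that it is total and unique on both sides, and that it is compact
(`isCompact_barycentricGraph_le`). Both projections of this compact graph are then continuous
bijections onto Hausdorff spaces, hence homeomorphisms. Since the relation is generated by the rules
of a barycentric parametrisation, uniqueness follows; joining a simplex with a barycentre
corresponds to adding a new top to a chain.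

For simplicial complexes, a combination of centroids along a chain becomes, after division by
cardinalities, a sum of indicator functions of simplices. Every nonnegative function supported on a
simplex is such a sum along exactly one chain, its layers (`exists_vertexWeight_eq`,
`vertexWeight_injective_of_isChain`). Together with uniqueness of barycentric coordinates this gives
a continuous bijection from a compact space. The last claim transports along the isomorphism of face
posets. -/

open Classical in
/-- The barycentric coordinates of a vertex. -/
noncomputable def vertexCoord {P : Type*} (p : P) : P → ℝ := Pi.single p 1

@[simp]
theorem vertexCoord_self {P : Type*} (p : P) : vertexCoord p p = 1 := by
  simp [vertexCoord]

@[simp]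
theorem vertexCoord_of_ne {P : Type*} {p q : P} (h : q ≠ p) : vertexCoord p q = 0 := by
  simp [vertexCoord, h]

theorem vertexCoord_nonneg {P : Type*} (p q : P) : 0 ≤ vertexCoord p q := by
  by_cases h : q = p
  · simp [h]
  · simp [h]

@[simp]
theorem sum_vertexCoord {P : Type*} [Fintype P] (p : P) : ∑ q, vertexCoord p q = 1 := by
  classical
  rw [Fintype.sum_eq_single p fun q hq => vertexCoord_of_ne hq, vertexCoord_self]

/-! ### Points of realised order complexes: supports, cones and functoriality. -/

section OrderComplex

variable {P : Type*} [PartialOrder P]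

theorem mem_closedSimplex_iff {ι : Type*} [Fintype ι] {s : Finset ι} {t : ι → ℝ} :
    t ∈ closedSimplex s ↔ (∀ v, 0 ≤ t v) ∧ (∀ v, v ∉ s → t v = 0) ∧ ∑ v, t v = 1 := by
  refine and_congr_right fun _ => and_congr_right fun h => ?_
  rw [Finset.sum_subset (Finset.subset_univ s) fun v _ hv => h v hv]

theorem isCompact_closedSimplex {ι : Type*} [Finite ι] (s : Finset ι) :
    IsCompact (closedSimplex s) := by
  refine (isCompact_Icc (a := (0 : ι → ℝ)) (b := 1)).of_isClosed_subset ?_ ?_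
  · simp only [closedSimplex, ofPred_and]
    refine IsClosed.inter ?_ (IsClosed.inter ?_ ?_)
    · simp only [ofPred_forall]
      exact isClosed_iInter fun v => isClosed_le continuous_const (continuous_apply v)
    · simp only [ofPred_forall]
      exact isClosed_iInter fun v => isClosed_iInter fun _ =>
        isClosed_eq (continuous_apply v) continuous_const
    · exact isClosed_eq (by fun_prop) continuous_const
  · rintro t ⟨h0, h1, h2⟩
    refine ⟨h0, fun v => ?_⟩
    by_cases hv : v ∈ s
    · exact (Finset.single_le_sum (fun i _ => h0 i) hv).trans h2.le
    · simp [h1 v hv]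

theorem isCompact_realization {ι : Type*} [Finite ι] (K : AbstractSimplicialComplex ι) :
    IsCompact (realization K) :=
  (toFinite _).isCompact_biUnion fun s _ => isCompact_closedSimplex s

/-- The support of `t` is the smallest simplex containing it, and total mass one keeps it non-empty.
Later arguments use supports and need not choose a chain. -/
theorem mem_realization_iff [Fintype P] {t : P → ℝ} :
    t ∈ realization (orderComplex P) ↔
      (∀ p, 0 ≤ t p) ∧ IsChain (· ≤ ·) {p | t p ≠ 0} ∧ ∑ p, t p = 1 := by
  classical
  simp only [realization, mem_iUnion₂, mem_closedSimplex_iff]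
  constructor
  · rintro ⟨s, hs, h0, h1, h2⟩
    refine ⟨h0, hs.2.mono fun p hp => ?_, h2⟩
    by_contra h
    exact hp (h1 p h)
  · rintro ⟨h0, h1, h2⟩
    refine ⟨Finset.univ.filter fun p => t p ≠ 0, ⟨?_, by simpa using h1⟩, h0, by simp, h2⟩
    by_contra h
    rw [Finset.not_nonempty_iff_eq_empty, Finset.filter_eq_empty_iff] at h
    rw [Finset.sum_eq_zero fun p hp => by simpa using h hp] at h2
    exact zero_ne_one h2

theorem exists_top_of_isChain [Finite P] {S : Set P} (hS : IsChain (· ≤ ·) S) (hne : S.Nonempty) :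
    ∃ p ∈ S, ∀ q ∈ S, q ≤ p := by
  obtain ⟨p, hp⟩ := S.toFinite.exists_maximal hne
  exact ⟨p, hp.1, fun q hq => (hS.total hq hp.1).elim id fun h => hp.2 hq h⟩

/-- Every point of the realisation has a largest vertex in its support. -/
theorem exists_top [Finite P] {t : P → ℝ} (ht : t ∈ realization (orderComplex P)) :
    ∃ p, t p ≠ 0 ∧ ∀ q, t q ≠ 0 → q ≤ p := by
  cases nonempty_fintype P
  obtain ⟨-, h1, h2⟩ := mem_realization_iff.1 ht
  refine exists_top_of_isChain (S := {p | t p ≠ 0}) h1 ?_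
  by_contra h
  rw [not_nonempty_iff_eq_empty, eq_empty_iff_forall_notMem] at h
  rw [Finset.sum_eq_zero fun p _ => by simpa using h p] at h2
  exact zero_ne_one h2

theorem vertex_mem_realization [Finite P] (p : P) :
    vertexCoord p ∈ realization (orderComplex P) := (vertex p).2

theorem cone_mem_realization [Finite P] {p : P} {u : P → ℝ}
    (hu : u ∈ realization (orderComplex P)) (hup : ∀ q, u q ≠ 0 → q < p) {r : ℝ}
    (hr : r ∈ Icc (0 : ℝ) 1) :
    r • u + (1 - r) • vertexCoord p ∈ realization (orderComplex P) := by
  cases nonempty_fintype P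
  obtain ⟨h0, h1, h2⟩ := mem_realization_iff.1 hu
  refine mem_realization_iff.2 ⟨fun q => ?_, ?_, ?_⟩
  · simpa using add_nonneg (mul_nonneg hr.1 (h0 q))
      (mul_nonneg (sub_nonneg.2 hr.2) (vertexCoord_nonneg p q))
  · refine (h1.insert (a := p) fun q hq _ => Or.inr (hup q hq).le).mono fun q hq => ?_
    by_cases hqp : q = p
    · exact Or.inl hqp
    · refine Or.inr fun h => hq ?_
      simp [h, hqp]
  · simp [Finset.sum_add_distrib, ← Finset.mul_sum, h2]

/-- A point of the realisation is the vertex `p` at the top of its support, or it lies on a segment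
from `p` to a point which is supported on smaller vertices. -/
theorem eq_vertex_or_exists_cone [Finite P] {t : P → ℝ} (ht : t ∈ realization (orderComplex P))
    {p : P} (hp : t p ≠ 0) :
    t = vertexCoord p ∨ ∃ r ∈ Ioo (0 : ℝ) 1, ∃ u ∈ realization (orderComplex P),
      (∀ q, u q ≠ 0 → t q ≠ 0 ∧ q ≠ p) ∧ t = r • u + (1 - r) • vertexCoord p := by
  classical
  cases nonempty_fintype P
  obtain ⟨h0, h1, h2⟩ := mem_realization_iff.1 ht
  have hsum : t p + ∑ q ∈ Finset.univ.erase p, t q = 1 := by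
    rw [Finset.add_sum_erase _ _ (Finset.mem_univ p), h2]
  have hle : t p ≤ 1 := by
    have : 0 ≤ ∑ q ∈ Finset.univ.erase p, t q := Finset.sum_nonneg fun q _ => h0 q
    linarith
  rcases hle.eq_or_lt with h | h
  · left
    have hz : ∑ q ∈ Finset.univ.erase p, t q = 0 := by linarith
    rw [Finset.sum_eq_zero_iff_of_nonneg fun q _ => h0 q] at hz
    ext q
    by_cases hq : q = p
    · subst hq; simp [h]
    · simp [hq, hz q (by simp [hq])]
  · right
    have hr : 0 < 1 - t p := by linarith
    have hpos : 0 < t p := (h0 p).lt_of_ne' hp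
    -- The mass away from `p` is `1 - t p`; `u` is that remainder, normalised to total mass one.
    refine ⟨1 - t p, ⟨hr, by linarith⟩, (1 - t p)⁻¹ • Function.update t p 0,
      mem_realization_iff.2 ⟨fun q => ?_, ?_, ?_⟩, fun q hq => ?_, ?_⟩
    · have : 0 ≤ Function.update t p 0 q := by
        by_cases hq : q = p
        · subst hq; simp
        · simp [hq, h0]
      exact mul_nonneg (inv_nonneg.2 hr.le) this
    · refine h1.mono fun q hq => ?_
      by_cases hqp : q = p
      · subst hqp; simp at hq
      · intro h; simp [hqp, h] at hq
    · have : ∑ q, Function.update t p 0 q = 1 - t p := by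
        rw [← Finset.add_sum_erase _ _ (Finset.mem_univ p), Function.update_self, zero_add,
          Finset.sum_congr rfl fun q hq => Function.update_of_ne (Finset.ne_of_mem_erase hq) _ _]
        linarith
      simp [← Finset.mul_sum, this, hr.ne']
    · by_cases hqp : q = p
      · subst hqp; simp at hq
      · refine ⟨fun h => ?_, hqp⟩
        simp [hqp, h] at hq
    · ext q
      by_cases hq : q = p
      · subst hq; simp
      · simp [hq, mul_inv_cancel_left₀ hr.ne']

theorem comp_mem_realization {Q : Type*} [PartialOrder Q] [Finite P] [Finite Q] (e : P ≃o Q)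
    {t : P → ℝ} (ht : t ∈ realization (orderComplex P)) :
    t ∘ e.symm ∈ realization (orderComplex Q) := by
  cases nonempty_fintype P
  cases nonempty_fintype Q
  obtain ⟨h0, h1, h2⟩ := mem_realization_iff.1 ht
  refine mem_realization_iff.2 ⟨fun q => h0 _, ?_, ?_⟩
  · intro p hp q hq hpq
    simpa using h1 hp hq (by simpa using hpq)
  · rw [← h2]
    exact e.symm.toEquiv.sum_comp t

/-- Isomorphic posets have homeomorphic order complexes. -/
def realizationCongr {Q : Type*} [PartialOrder Q] [Finite P] [Finite Q] (e : P ≃o Q) :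
    realization (orderComplex P) ≃ₜ realization (orderComplex Q) where
  toFun t := ⟨t.1 ∘ e.symm, comp_mem_realization e t.2⟩
  invFun t := ⟨t.1 ∘ e, comp_mem_realization e.symm t.2⟩
  left_inv t := by ext p; simp
  right_inv t := by ext p; simp
  continuous_toFun := by
    refine Continuous.subtype_mk (continuous_pi fun q => ?_) _
    exact (continuous_apply (e.symm q)).comp continuous_subtype_val
  continuous_invFun := by
    refine Continuous.subtype_mk (continuous_pi fun q => ?_) _
    exact (continuous_apply (e q)).comp continuous_subtype_val

end OrderComplex

/-! ### Barycentric subdivision of simplicial complexes -/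

section Weights

variable {E : Type*} {F : Set (Finset E)} [Fintype F]

theorem sub_single_nonneg {ι : Type*} [DecidableEq ι] {a : ι → ℝ} (ha : ∀ s, 0 ≤ a s) {σ : ι}
    {c : ℝ} (hc : c ≤ a σ) (s : ι) : 0 ≤ (a - Pi.single σ c : ι → ℝ) s := by
  by_cases hs : s = σ
  · subst hs; simpa using hc
  · simpa [hs] using ha s

theorem support_sub_single_subset {ι : Type*} [DecidableEq ι] {a : ι → ℝ} {σ : ι}
    (hσ : a σ ≠ 0) (c : ℝ) : {s | (a - Pi.single σ c : ι → ℝ) s ≠ 0} ⊆ {s | a s ≠ 0} :=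
    fun s hs h => by
  by_cases hsσ : s = σ
  · exact hσ (hsσ ▸ h)
  · exact hs (by simp [hsσ, show a s = 0 from h])

/-- The weights on the vertices which are obtained by adding up multiples of the indicator
functions of simplices. -/
noncomputable def vertexWeight : (F → ℝ) →ₗ[ℝ] (E → ℝ) :=
  Fintype.linearCombination ℝ fun s : F => Set.indicator (s.1 : Set E) (1 : E → ℝ)

open Classical in
theorem vertexWeight_apply (a : F → ℝ) (v : E) :
    vertexWeight a v = ∑ s : F, if v ∈ s.1 then a s else 0 := by
  simp [vertexWeight, Fintype.linearCombination_apply, indicator_apply]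

open Classical in
theorem vertexWeight_single (s : F) (c : ℝ) (v : E) :
    vertexWeight (Pi.single s c) v = if v ∈ s.1 then c else 0 := by
  simp [vertexWeight, Fintype.linearCombination_apply_single, indicator_apply]

theorem vertexWeight_nonneg {a : F → ℝ} (ha : ∀ s, 0 ≤ a s) (v : E) : 0 ≤ vertexWeight a v := by
  classical
  rw [vertexWeight_apply]
  exact Finset.sum_nonneg fun s _ => by split_ifs <;> simp [ha]

theorem vertexWeight_ne_zero_iff {a : F → ℝ} (ha : ∀ s, 0 ≤ a s) (v : E) :
    vertexWeight a v ≠ 0 ↔ ∃ s, a s ≠ 0 ∧ v ∈ s.1 := by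
  classical
  rw [vertexWeight_apply, Ne, Finset.sum_eq_zero_iff_of_nonneg fun s _ => by
    split_ifs <;> simp [ha]]
  simp only [Finset.mem_univ, true_imp_iff, not_forall, ite_eq_right_iff, exists_prop]
  exact exists_congr fun s => and_comm

/-- Nonnegative coefficients cannot cancel, and the union of a chain is its top. Hence the top can
be read off from the weights. -/
theorem vertexWeight_ne_zero_iff_mem_top {a : F → ℝ} (ha : ∀ s, 0 ≤ a s) {σ : F} (hσ : a σ ≠ 0)
    (htop : ∀ s, a s ≠ 0 → s ≤ σ) (v : E) : vertexWeight a v ≠ 0 ↔ v ∈ σ.1 := by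
  rw [vertexWeight_ne_zero_iff ha]
  exact ⟨fun ⟨s, hs, hv⟩ => htop s hs hv, fun hv => ⟨σ, hσ, hv⟩⟩

theorem eq_zero_of_vertexWeight_eq_zero (hF : ∀ s ∈ F, s.Nonempty) {a : F → ℝ}
    (ha : ∀ s, 0 ≤ a s) (h : vertexWeight a = 0) : a = 0 := by
  ext s
  by_contra hs
  obtain ⟨v, hv⟩ := hF s.1 s.2
  exact (vertexWeight_ne_zero_iff ha v).2 ⟨s, hs, hv⟩ (congrFun h v)

theorem card_support_sub_single_lt [DecidableEq F] {a : F → ℝ} {σ : F} (hσ : a σ ≠ 0) :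
    (Finset.univ.filter fun s => (a - Pi.single σ (a σ) : F → ℝ) s ≠ 0).card <
      (Finset.univ.filter fun s => a s ≠ 0).card := by
  refine Finset.card_lt_card ((Finset.ssubset_iff_of_subset fun s hs => ?_).2 ⟨σ, ?_, ?_⟩)
  · simp only [Finset.mem_filter, Finset.mem_univ, true_and] at hs ⊢
    intro h
    by_cases hsσ : s = σ
    · exact hσ (hsσ ▸ h)
    · simp [hsσ, h] at hs
  · simpa using hσ
  · simp

/-- Coefficients supported on a chain are determined by the weights of the vertices. -/
theorem vertexWeight_injective_of_isChain (hF : ∀ s ∈ F, s.Nonempty) {a b : F → ℝ}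
    (ha : ∀ s, 0 ≤ a s) (hb : ∀ s, 0 ≤ b s) (hca : IsChain (· ≤ ·) {s | a s ≠ 0})
    (hcb : IsChain (· ≤ ·) {s | b s ≠ 0}) (h : vertexWeight a = vertexWeight b) : a = b := by
  classical
  induction hn : (Finset.univ.filter fun s => a s ≠ 0).card +
    (Finset.univ.filter fun s => b s ≠ 0).card using Nat.strong_induction_on generalizing a b with
  | _ n ih =>
  subst hn
  by_cases ha0 : a = 0
  · subst ha0
    exact (eq_zero_of_vertexWeight_eq_zero hF hb (by rw [← h, map_zero])).symm
  by_cases hb0 : b = 0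
  · subst hb0
    exact eq_zero_of_vertexWeight_eq_zero hF ha (by rw [h, map_zero])
  obtain ⟨σ, hσ, hσt⟩ := exists_top_of_isChain hca (Function.ne_iff.1 ha0)
  obtain ⟨τ, hτ, hτt⟩ := exists_top_of_isChain hcb (Function.ne_iff.1 hb0)
  obtain rfl : σ = τ := by
    ext v
    rw [← vertexWeight_ne_zero_iff_mem_top ha hσ hσt, h,
      vertexWeight_ne_zero_iff_mem_top hb hτ hτt]
  -- Subtract the same multiple of the common top from both sides. With `c` the smaller of `a σ` and
  -- `b σ`, the top leaves at least one support, so the total size drops.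
  have key : ∀ c, c ≤ a σ → c ≤ b σ →
      (Finset.univ.filter fun s => (a - Pi.single σ c : F → ℝ) s ≠ 0).card +
        (Finset.univ.filter fun s => (b - Pi.single σ c : F → ℝ) s ≠ 0).card <
      (Finset.univ.filter fun s => a s ≠ 0).card +
        (Finset.univ.filter fun s => b s ≠ 0).card → a = b := fun c hac hbc hlt =>
    sub_left_inj.1 (ih _ hlt (sub_single_nonneg ha hac) (sub_single_nonneg hb hbc)
      (hca.mono (support_sub_single_subset hσ c)) (hcb.mono (support_sub_single_subset hτ c))
      (by rw [map_sub, map_sub, h]) rfl)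
  have hle : ∀ {a : F → ℝ}, a σ ≠ 0 → ∀ c,
      (Finset.univ.filter fun s => (a - Pi.single σ c : F → ℝ) s ≠ 0).card ≤
        (Finset.univ.filter fun s => a s ≠ 0).card := fun hσ c =>
    Finset.card_le_card fun s hs => by
      simpa using support_sub_single_subset hσ c (by simpa using hs)
  rcases le_total (a σ) (b σ) with hab | hab
  · exact key _ le_rfl hab (add_lt_add_of_lt_of_le (card_support_sub_single_lt hσ) (hle hτ _))
  · exact key _ hab le_rfl (add_lt_add_of_le_of_lt (hle hσ _) (card_support_sub_single_lt hτ))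

/-- All weights whose support is a simplex come from coefficients supported on a chain. -/
theorem exists_vertexWeight_eq
    (hF : ∀ s ∈ F, ∀ t : Finset E, t ⊆ s → t.Nonempty → t ∈ F) {w : E → ℝ} (hw : ∀ v, 0 ≤ w v)
    {σ : Finset E} (hσ : ∀ v, w v ≠ 0 ↔ v ∈ σ) (hσF : σ.Nonempty → σ ∈ F) :
    ∃ a : F → ℝ, (∀ s, 0 ≤ a s) ∧ IsChain (· ≤ ·) {s | a s ≠ 0} ∧ (∀ s, a s ≠ 0 → s.1 ⊆ σ) ∧
      vertexWeight a = w := by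
  classical
  induction hn : σ.card using Nat.strong_induction_on generalizing σ w with
  | _ n ih =>
  subst hn
  rcases σ.eq_empty_or_nonempty with rfl | hne
  · refine ⟨0, by simp, by simp [IsChain, Set.Pairwise], by simp, ?_⟩
    rw [map_zero]
    ext v
    simpa [eq_comm] using hσ v
  -- Peel off the bottom layer: the minimal weight on `σ` becomes the coefficient of `σ`. The rest
  -- is still nonnegative and vanishes at `v₀`, so its support is a proper subset of `σ`.
  obtain ⟨v₀, hv₀, hmin⟩ := σ.exists_min_image w hne
  have hpos : 0 < w v₀ := (hw v₀).lt_of_ne' ((hσ v₀).2 hv₀)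
  let w' : E → ℝ := fun v => w v - if v ∈ σ then w v₀ else 0
  have hw' : ∀ v, 0 ≤ w' v := fun v => by
    by_cases hv : v ∈ σ
    · simpa [w', hv] using hmin v hv
    · simpa [w', hv] using hw v
  have hsub : (σ.filter fun v => w' v ≠ 0) ⊆ σ := Finset.filter_subset _ _
  have hss : (σ.filter fun v => w' v ≠ 0) ⊂ σ :=
    (Finset.ssubset_iff_of_subset hsub).2 ⟨v₀, hv₀, by simp [w', hv₀]⟩
  obtain ⟨a, ha, hca, has, haw⟩ := ih _ (Finset.card_lt_card hss) hw'
    (σ := σ.filter fun v => w' v ≠ 0) (fun v => by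
      simp only [Finset.mem_filter, iff_and_self]
      intro hv
      by_contra hvσ
      exact hv (by simpa [w', hvσ] using (hσ v).not.2 hvσ))
    (fun h => hF σ (hσF hne) _ hsub h) rfl
  refine ⟨a + Pi.single ⟨σ, hσF hne⟩ (w v₀), fun s => ?_, ?_, fun s hs => ?_, ?_⟩
  · exact add_nonneg (ha s)
      ((Pi.single_nonneg.2 hpos.le : (0 : F → ℝ) ≤ Pi.single ⟨σ, hσF hne⟩ (w v₀)) s)
  · refine (hca.insert (a := (⟨σ, hσF hne⟩ : F)) fun q hq _ =>
      Or.inr ((has q hq).trans hsub)).mono fun q hq => ?_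
    by_cases hqp : q = ⟨σ, hσF hne⟩
    · exact Or.inl hqp
    · exact Or.inr fun h => hq (by simp [show a q = 0 from h, hqp])
  · by_cases hqp : s = ⟨σ, hσF hne⟩
    · simp [hqp]
    · exact (has s fun h => hs (by simp [h, hqp])).trans hsub
  · ext v
    rw [map_add, haw, Pi.add_apply, vertexWeight_single]
    simp [w']

/-- Exchange of summation. With `f` the identity it compares points, with `f = 1` total masses. -/
theorem sum_vertexWeight_smul (a : F → ℝ) {M : Type*} [AddCommGroup M] [Module ℝ M] (f : E → M)
    {U : Finset E} (hU : ∀ s : F, a s ≠ 0 → s.1 ⊆ U) :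
    ∑ v ∈ U, vertexWeight a v • f v = ∑ s : F, a s • ∑ v ∈ s.1, f v := by
  classical
  simp only [vertexWeight_apply, Finset.sum_smul, ite_smul, zero_smul]
  rw [Finset.sum_comm]
  refine Finset.sum_congr rfl fun s _ => ?_
  by_cases hs : a s = 0
  · simp [hs]
  · rw [Finset.sum_ite_mem, Finset.inter_eq_right.2 (hU s hs), Finset.smul_sum]

theorem sum_vertexWeight (a : F → ℝ) {U : Finset E} (hU : ∀ s : F, a s ≠ 0 → s.1 ⊆ U) :
    ∑ v ∈ U, vertexWeight a v = ∑ s : F, a s * s.1.card := by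
  simpa using sum_vertexWeight_smul a (fun _ => (1 : ℝ)) hU

end Weights

/-! ### The barycentric homeomorphism onto a polyhedron. -/

section Simplicial

variable {E : Type*} [AddCommGroup E] [Module ℝ E]

/-- The barycentric coordinates of a point of a simplicial complex are unique. -/
theorem barycentric_coords_unique (K : Geometry.SimplicialComplex ℝ E) {s s' : Finset E}
    (hs : s ∈ K.faces) (hs' : s' ∈ K.faces) {w w' : E → ℝ} (hw : ∀ v, 0 ≤ w v)
    (hw' : ∀ v, 0 ≤ w' v) (hws : ∀ v, v ∉ s → w v = 0) (hws' : ∀ v, v ∉ s' → w' v = 0)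
    (h1 : ∑ v ∈ s, w v = 1) (h1' : ∑ v ∈ s', w' v = 1)
    (h : ∑ v ∈ s, w v • v = ∑ v ∈ s', w' v • v) : w = w' := by
  classical
  -- Within a single simplex, uniqueness is affine independence of the vertices.
  have aux : ∀ {s : Finset E}, s ∈ K.faces → ∀ {w w' : E → ℝ}, (∀ v, v ∉ s → w v = 0) →
      (∀ v, v ∉ s → w' v = 0) → ∑ v ∈ s, w v = ∑ v ∈ s, w' v →
      ∑ v ∈ s, w v • v = ∑ v ∈ s, w' v • v → w = w' := by
    intro s hs w w' hws hws' h1 h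
    ext v
    by_cases hv : v ∈ s
    · refine sub_eq_zero.1 (affineIndependent_iff.1 (K.indep hs) Finset.univ
        (fun v : s => w v - w' v) ?_ ?_ ⟨v, hv⟩ (Finset.mem_univ _))
      · rw [Finset.univ_eq_attach, Finset.sum_attach s fun v => w v - w' v,
          Finset.sum_sub_distrib, h1, sub_self]
      · rw [Finset.univ_eq_attach, Finset.sum_attach s fun v => (w v - w' v) • v]
        simp only [sub_smul, Finset.sum_sub_distrib, h, sub_self]
    · rw [hws v hv, hws' v hv]
  -- Two simplices meet in the hull of their common vertices. Coordinates there, extended by zero to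
  -- `u'`, can be compared with `w` inside `s` and with `w'` inside `s'`.
  have hx : ∑ v ∈ s, w v • v ∈ convexHull ℝ (↑(s ∩ s') : Set E) := by
    rw [Finset.coe_inter]
    exact K.inter_subset_convexHull hs hs'
      ⟨Finset.mem_convexHull'.2 ⟨w, fun v _ => hw v, h1, rfl⟩,
        Finset.mem_convexHull'.2 ⟨w', fun v _ => hw' v, h1', h.symm⟩⟩
  obtain ⟨u, -, hu1, hu⟩ := Finset.mem_convexHull'.1 hx
  let u' : E → ℝ := fun v => if v ∈ s ∩ s' then u v else 0
  have sum_eq : ∀ {M : Type _} [AddCommGroup M] [Module ℝ M] (f : E → M) {s₀ : Finset E},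
      s ∩ s' ⊆ s₀ → ∑ v ∈ s₀, u' v • f v = ∑ v ∈ s ∩ s', u v • f v := by
    intro M _ _ f s₀ hs₀
    rw [← Finset.sum_subset hs₀ fun v _ hv => by simp only [u', if_neg hv, zero_smul]]
    exact Finset.sum_congr rfl fun v hv => by simp only [u', if_pos hv]
  have l := Finset.inter_subset_left (s₁ := s) (s₂ := s')
  have r := Finset.inter_subset_right (s₁ := s) (s₂ := s')
  have e1 : ∀ {s₀ : Finset E}, s ∩ s' ⊆ s₀ → ∑ v ∈ s₀, u' v = 1 := fun hs₀ => by
    simp only [u', ← hu1, Finset.sum_ite_mem, Finset.inter_eq_right.2 hs₀]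
  have e2 : ∀ {s₀ : Finset E}, s ∩ s' ⊆ s₀ → ∑ v ∈ s₀, u' v • v = ∑ v ∈ s, w v • v :=
    fun hs₀ => by rw [← hu]; exact sum_eq id hs₀
  have z : ∀ {s₀ : Finset E}, s ∩ s' ⊆ s₀ → ∀ v, v ∉ s₀ → u' v = 0 := fun hs₀ v hv =>
    if_neg fun h => hv (hs₀ h)
  exact (aux hs hws (z l) (by rw [h1, e1 l]) (e2 l).symm).trans
    (aux hs' (z r) hws' (by rw [h1', e1 r]) (by rw [e2 r, h]))

theorem centroid_id_eq {s : Finset E} (hs : s.Nonempty) :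
    s.centroid ℝ id = (s.card : ℝ)⁻¹ • ∑ v ∈ s, v := by
  rw [Finset.centroid_def, Finset.affineCombination_eq_linear_combination _ _ _
    (s.sum_centroidWeights_eq_one_of_nonempty ℝ hs), Finset.smul_sum]
  simp

/-- The barycentric subdivision map from the realised order complex of the face poset. -/
theorem exists_barycentric_homeomorph [TopologicalSpace E] [IsTopologicalAddGroup E]
    [ContinuousSMul ℝ E] [T2Space E] (K : Geometry.SimplicialComplex ℝ E) [Finite K.faces] :
    ∃ Φ : realization (orderComplex K.faces) ≃ₜ K.space,
      ∀ t, (Φ t : E) = ∑ᶠ s : K.faces, t.1 s • s.1.centroid ℝ id := by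
  classical
  cases nonempty_fintype K.faces
  let f : (K.faces → ℝ) → E := fun t => ∑ s : K.faces, t s • s.1.centroid ℝ id
  have hne : ∀ s ∈ K.faces, s.Nonempty := fun s hs => K.nonempty_of_mem_faces hs
  have hcard : ∀ s : K.faces, (s.1.card : ℝ) ≠ 0 := fun s => by
    exact_mod_cast (hne s.1 s.2).card_pos.ne'
  -- A centroid is a vertex sum divided by the cardinality; absorbing this factor turns `f t` into
  -- the combination with coefficients `vertexWeight (A t)`.
  let A : (K.faces → ℝ) → K.faces → ℝ := fun t s => t s * (s.1.card : ℝ)⁻¹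
  have hA : ∀ t s, A t s ≠ 0 ↔ t s ≠ 0 := fun t s => by simp [A, hcard s]
  have hA0 : ∀ {t}, (∀ s, 0 ≤ t s) → ∀ s, 0 ≤ A t s := fun ht s =>
    mul_nonneg (ht s) (inv_nonneg.2 (Nat.cast_nonneg _))
  have hfA : ∀ t, f t = ∑ s : K.faces, A t s • ∑ v ∈ s.1, v := fun t =>
    Finset.sum_congr rfl fun s _ => by rw [centroid_id_eq (hne s.1 s.2), smul_smul]
  have hsA : ∀ t, ∑ s : K.faces, A t s * s.1.card = ∑ s, t s := fun t =>
    Finset.sum_congr rfl fun s _ => by simp [A, hcard s]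
  have coords : ∀ t ∈ realization (orderComplex K.faces), ∃ σ ∈ K.faces,
      (∀ v, v ∉ σ → vertexWeight (A t) v = 0) ∧ ∑ v ∈ σ, vertexWeight (A t) v = 1 ∧
        ∑ v ∈ σ, vertexWeight (A t) v • v = f t := by
    intro t ht
    obtain ⟨h0, h1, h2⟩ := mem_realization_iff.1 ht
    obtain ⟨σ, hσ, hσt⟩ := exists_top ht
    have hU : ∀ s : K.faces, A t s ≠ 0 → s.1 ⊆ σ.1 := fun s hs => hσt s ((hA t s).1 hs)
    refine ⟨σ.1, σ.2, fun v hv => ?_, ?_, ?_⟩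
    · have := (vertexWeight_ne_zero_iff_mem_top (hA0 h0) ((hA t σ).2 hσ) hU v).not.2 hv
      simpa using this
    · rw [sum_vertexWeight _ hU, hsA, h2]
    · rw [sum_vertexWeight_smul _ (fun v => v) hU, hfA]
  have hmaps : MapsTo f (realization (orderComplex K.faces)) K.space := fun t ht => by
    obtain ⟨σ, hσ, -, h1, h⟩ := coords t ht
    refine K.convexHull_subset_space hσ (Finset.mem_convexHull'.2 ⟨_, fun v _ => ?_, h1, h⟩)
    exact vertexWeight_nonneg (hA0 (mem_realization_iff.1 ht).1) v
  have hinj : InjOn f (realization (orderComplex K.faces)) := fun t ht t' ht' heq => by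
    obtain ⟨h0, hc, -⟩ := mem_realization_iff.1 ht
    obtain ⟨h0', hc', -⟩ := mem_realization_iff.1 ht'
    obtain ⟨σ, hσ, hz, h1, h⟩ := coords t ht
    obtain ⟨σ', hσ', hz', h1', h'⟩ := coords t' ht'
    have hw := barycentric_coords_unique K hσ hσ' (vertexWeight_nonneg (hA0 h0))
      (vertexWeight_nonneg (hA0 h0')) hz hz' h1 h1' (by rw [h, h', heq])
    have := vertexWeight_injective_of_isChain hne (hA0 h0) (hA0 h0') (by simpa only [hA] using hc)
      (by simpa only [hA] using hc') hw
    ext s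
    exact mul_right_cancel₀ (inv_ne_zero (hcard s)) (congrFun this s)
  have hsurj : SurjOn f (realization (orderComplex K.faces)) K.space := fun x hx => by
    obtain ⟨s, hs, hxs⟩ := K.mem_space_iff.1 hx
    obtain ⟨w, hw0, hw1, hwx⟩ := Finset.mem_convexHull'.1 hxs
    let w' : E → ℝ := fun v => if v ∈ s then w v else 0
    have hσ : ∀ v, w' v ≠ 0 ↔ v ∈ s.filter fun v => w v ≠ 0 := fun v => by simp [w']
    obtain ⟨a, ha, hca, has, haw⟩ := exists_vertexWeight_eq (F := K.faces)
      (fun s hs t hts ht => K.down_closed hs hts ht) (w := w')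
      (fun v => by by_cases hv : v ∈ s <;> simp [w', hv, hw0]) hσ
      (fun h => K.down_closed hs (Finset.filter_subset _ _) h)
    have hU : ∀ r : K.faces, a r ≠ 0 → r.1 ⊆ s := fun r hr =>
      (has r hr).trans (Finset.filter_subset _ _)
    have hAa : A (fun r => a r * r.1.card) = a := by
      ext r
      simp [A, hcard r]
    refine ⟨fun r => a r * r.1.card, mem_realization_iff.2 ⟨fun r => ?_, ?_, ?_⟩, ?_⟩
    · exact mul_nonneg (ha r) (Nat.cast_nonneg _)
    · refine hca.mono fun r (hr : a r * r.1.card ≠ 0) => left_ne_zero_of_mul hr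
    · rw [← sum_vertexWeight a hU, haw, ← hw1]
      exact Finset.sum_congr rfl fun v hv => if_pos hv
    · rw [hfA, hAa, ← sum_vertexWeight_smul a (fun v => v) hU, haw, ← hwx]
      exact Finset.sum_congr rfl fun v hv => by simp only [w', if_pos hv]
  have hcont : Continuous f :=
    continuous_finsetSum _ fun s _ => (continuous_apply s).smul continuous_const
  have : CompactSpace (realization (orderComplex K.faces)) :=
    isCompact_iff_compactSpace.1 (isCompact_realization _)
  have hcont' : Continuous (BijOn.equiv f ⟨hmaps, hinj, hsurj⟩) :=
    (hcont.comp continuous_subtype_val).subtype_mk _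
  exact ⟨hcont'.homeoOfEquivCompactToT2, fun t => (finsum_eq_sum_of_fintype _).symm⟩

end Simplicial

/-! ### Cells of regular CW complexes -/

section Cells

variable {X : Type*} [TopologicalSpace X] {C : Set X} [CWComplex C]

/-- The frontier is covered by open cells of smaller dimension, and distinct open cells are
disjoint. -/
theorem notMem_cellFrontier_of_mem_openCell {n : ℕ} {i : RelCWComplex.cell C n} {x : X}
    (hx : x ∈ RelCWComplex.openCell n i) : x ∉ RelCWComplex.cellFrontier n i := fun h => by
  obtain ⟨I, hI⟩ := CWComplex.cellFrontier_subset_finite_openCell n i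
  obtain ⟨m, hm, j, -, hj⟩ : ∃ m < n, ∃ j ∈ I m, x ∈ RelCWComplex.openCell m j := by
    simpa using hI h
  have := RelCWComplex.eq_of_not_disjoint_openCell (not_disjoint_iff.2 ⟨x, hx, hj⟩)
  exact hm.ne' (congrArg Sigma.fst this)

theorem cell_eq_of_mem_openCell {n m : ℕ} {i : RelCWComplex.cell C n} {j : RelCWComplex.cell C m}
    {x : X} (hi : x ∈ RelCWComplex.openCell n i) (hj : x ∈ RelCWComplex.openCell m j) :
    (⟨n, i⟩ : Σ n, RelCWComplex.cell C n) = ⟨m, j⟩ :=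
  RelCWComplex.eq_of_not_disjoint_openCell (not_disjoint_iff.2 ⟨x, hi, hj⟩)

theorem IsCellChart.image_ball {n : ℕ} {i : RelCWComplex.cell C n} {f : (Fin n → ℝ) → X}
    (hf : IsCellChart i f) : f '' ball 0 1 = RelCWComplex.openCell n i := by
  rw [← closedBall_sdiff_sphere,
    hf.injOn.image_sdiff_subset sphere_subset_closedBall, hf.image_closedBall, hf.image_sphere,
    ← RelCWComplex.cellFrontier_union_openCell_eq_closedCell]
  refine union_sdiff_cancel_left ?_
  rintro x ⟨hx, hx'⟩
  exact notMem_cellFrontier_of_mem_openCell hx' hx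

theorem IsCellChart.apply_zero_mem {n : ℕ} {i : RelCWComplex.cell C n} {f : (Fin n → ℝ) → X}
    (hf : IsCellChart i f) : f 0 ∈ RelCWComplex.openCell n i :=
  hf.image_ball ▸ mem_image_of_mem f (mem_ball_self one_pos)

theorem norm_smul_of_mem_sphere {n : ℕ} {y : Fin n → ℝ} (hy : y ∈ sphere (0 : Fin n → ℝ) 1)
    {r : ℝ} (hr : 0 ≤ r) : ‖r • y‖ = r := by
  rw [norm_smul, mem_sphere_zero_iff_norm.1 hy, Real.norm_of_nonneg hr, mul_one]

theorem IsCellChart.apply_smul_mem {n : ℕ} {i : RelCWComplex.cell C n} {f : (Fin n → ℝ) → X}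
    (hf : IsCellChart i f) {y : Fin n → ℝ} (hy : y ∈ sphere (0 : Fin n → ℝ) 1)
    {r : ℝ} (hr : r ∈ Ico (0 : ℝ) 1) : f (r • y) ∈ RelCWComplex.openCell n i :=
  hf.image_ball ▸ mem_image_of_mem f
    (mem_ball_zero_iff.2 ((norm_smul_of_mem_sphere hy hr.1).trans_lt hr.2))

theorem exists_mem_openCell {x : X} (hx : x ∈ C) :
    ∃ (n : ℕ) (i : RelCWComplex.cell C n), x ∈ RelCWComplex.openCell n i := by
  rw [← CWComplex.iUnion_openCell_eq_complex (C := C)] at hx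
  simpa using hx

variable [T2Space X]

/-- This is where frontiers being unions of open cells enters: a frontier that meets an open cell
contains all of it and, being closed, also its closure. -/
theorem closedCell_subset_cellFrontier (hC : IsRegularCW C) {n m : ℕ} {i : RelCWComplex.cell C n}
    {j : RelCWComplex.cell C m} {x : X} (hj : x ∈ RelCWComplex.openCell m j)
    (hi : x ∈ RelCWComplex.cellFrontier n i) :
    RelCWComplex.closedCell m j ⊆ RelCWComplex.cellFrontier n i := by
  obtain ⟨I, -, hI⟩ := hC.frontier_eq n i
  rw [← RelCWComplex.closure_openCell_eq_closedCell]
  refine closure_minimal ?_ RelCWComplex.isClosed_cellFrontier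
  rw [hI] at hi ⊢
  obtain ⟨p, hp, hxp⟩ := mem_iUnion₂.1 hi
  obtain rfl : p = ⟨m, j⟩ := cell_eq_of_mem_openCell hxp hj
  exact subset_biUnion_of_mem (u := fun p : Σ n, RelCWComplex.cell C n =>
    RelCWComplex.openCell p.1 p.2) hp

theorem face_lt_face (hC : IsRegularCW C) {n m : ℕ} {i : RelCWComplex.cell C n}
    {j : RelCWComplex.cell C m} {x : X} (hj : x ∈ RelCWComplex.openCell m j)
    (hi : x ∈ RelCWComplex.cellFrontier n i) : (face j : FacePoset C) < face i := by
  have h := closedCell_subset_cellFrontier hC hj hi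
  refine lt_of_le_not_ge (h.trans (RelCWComplex.cellFrontier_subset_closedCell n i)) fun hle => ?_
  obtain ⟨z, hz⟩ := RelCWComplex.openCell_nonempty n i
  exact notMem_cellFrontier_of_mem_openCell hz
    (h (hle (RelCWComplex.openCell_subset_closedCell n i hz)))

theorem mem_openCell_or_face_lt_face (hC : IsRegularCW C) {n m : ℕ} {i : RelCWComplex.cell C n}
    {j : RelCWComplex.cell C m} {x : X} (hj : x ∈ RelCWComplex.openCell m j)
    (hi : x ∈ RelCWComplex.closedCell n i) :
    (⟨m, j⟩ : Σ n, RelCWComplex.cell C n) = ⟨n, i⟩ ∨ (face j : FacePoset C) < face i := by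
  rw [← RelCWComplex.cellFrontier_union_openCell_eq_closedCell] at hi
  exact hi.symm.imp (cell_eq_of_mem_openCell hj) (face_lt_face hC hj)

theorem face_le_face (hC : IsRegularCW C) {n m : ℕ} {i : RelCWComplex.cell C n}
    {j : RelCWComplex.cell C m} {x : X} (hj : x ∈ RelCWComplex.openCell m j)
    (hi : x ∈ RelCWComplex.closedCell n i) : (face j : FacePoset C) ≤ face i := by
  rcases mem_openCell_or_face_lt_face hC hj hi with h | h
  · cases h
    exact le_rfl
  · exact h.le

/-- The face poset remembers closed cells only as sets; dimension and index are recovered here, so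
that equal faces have the same chart. -/
theorem face_injective (hC : IsRegularCW C) {n m : ℕ} {i : RelCWComplex.cell C n}
    {j : RelCWComplex.cell C m} (h : (face i : FacePoset C) = face j) :
    (⟨n, i⟩ : Σ n, RelCWComplex.cell C n) = ⟨m, j⟩ := by
  obtain ⟨x, hx⟩ := RelCWComplex.openCell_nonempty n i
  have hx' : x ∈ RelCWComplex.closedCell m j :=
    (congrArg Subtype.val h).subset (RelCWComplex.openCell_subset_closedCell n i hx)
  exact (mem_openCell_or_face_lt_face hC hx hx').resolve_right h.not_lt

theorem closedCell_subset_cellFrontier_of_lt (hC : IsRegularCW C) {n m : ℕ}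
    {i : RelCWComplex.cell C n} {j : RelCWComplex.cell C m} (h : (face j : FacePoset C) < face i) :
    RelCWComplex.closedCell m j ⊆ RelCWComplex.cellFrontier n i := by
  obtain ⟨x, hx⟩ := RelCWComplex.openCell_nonempty m j
  have hx' := h.le (RelCWComplex.openCell_subset_closedCell m j hx)
  change x ∈ RelCWComplex.closedCell n i at hx'
  rw [← RelCWComplex.cellFrontier_union_openCell_eq_closedCell] at hx'
  rcases hx' with hx' | hx'
  · exact closedCell_subset_cellFrontier hC hx hx'
  · cases cell_eq_of_mem_openCell hx hx'
    exact (lt_irrefl _ h).elim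

end Cells

/-! ### The graph of the barycentric parametrisation -/

section Graph

variable {X : Type*} [TopologicalSpace X] {C : Set X} [CWComplex C]
  {φ : ∀ n : ℕ, RelCWComplex.cell C n → (Fin n → ℝ) → X}

/-- The graph of the barycentric parametrisation with respect to the charts `φ`: the vertex of a
cell corresponds to the barycentre, and radii of the cell correspond to segments which end in this
vertex. -/
inductive BarycentricGraph (φ : ∀ n : ℕ, RelCWComplex.cell C n → (Fin n → ℝ) → X) :
    (FacePoset C → ℝ) → X → Prop
  | vertex {n : ℕ} (i : RelCWComplex.cell C n) :
      BarycentricGraph φ (vertexCoord (face i)) (φ n i 0)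
  | cone {n : ℕ} (i : RelCWComplex.cell C n) {u : FacePoset C → ℝ} {y : Fin n → ℝ} {r : ℝ} :
      BarycentricGraph φ u (φ n i y) → (∀ ρ, u ρ ≠ 0 → ρ < face i) → y ∈ sphere 0 1 →
        r ∈ Ioo (0 : ℝ) 1 →
        BarycentricGraph φ (r • u + (1 - r) • vertexCoord (face i)) (φ n i (r • y))

theorem cone_apply_self {P : Type*} [PartialOrder P] {p : P} {u : P → ℝ}
    (hu : ∀ q, u q ≠ 0 → q < p) (r : ℝ) :
    (r • u + (1 - r) • vertexCoord p) p = 1 - r := by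
  have : u p = 0 := by
    by_contra h
    exact lt_irrefl p (hu p h)
  simp [this]

theorem le_of_cone_apply_ne_zero {P : Type*} [PartialOrder P] {p : P} {u : P → ℝ}
    (hu : ∀ q, u q ≠ 0 → q < p) (r : ℝ) (q : P)
    (hq : (r • u + (1 - r) • vertexCoord p) q ≠ 0) : q ≤ p := by
  by_cases hqp : q = p
  · exact hqp.le
  · refine (hu q fun h => hq ?_).le
    simp [h, hqp]

/-- As `r < 1`, the apex is the top of the support, and its coordinate is `1 - r`. Only `r • u` is
determined, because `r = 0` forgets `u`. -/
theorem cone_injective {P : Type*} [PartialOrder P] {p p' : P} {u u' : P → ℝ} {r r' : ℝ}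
    (hu : ∀ q, u q ≠ 0 → q < p) (hu' : ∀ q, u' q ≠ 0 → q < p') (hr : r < 1) (hr' : r' < 1)
    (h : r • u + (1 - r) • vertexCoord p =
      r' • u' + (1 - r') • vertexCoord p') :
    p = p' ∧ r = r' ∧ r • u = r' • u' := by
  obtain rfl : p = p' := by
    refine le_antisymm (le_of_cone_apply_ne_zero hu' r' p ?_)
      (le_of_cone_apply_ne_zero hu r p' ?_)
    · rw [← h, cone_apply_self hu]
      linarith
    · rw [h, cone_apply_self hu']
      linarith
  have hrr : r = r' := by
    have := congrFun h p
    rw [cone_apply_self hu, cone_apply_self hu'] at this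
    linarith
  subst hrr
  exact ⟨rfl, rfl, add_right_cancel h⟩

/-- A uniform inversion principle: a vertex counts as a cone with `r = 0` and placeholder values `u
= 0`, `y = 0`, so the base is constrained only for `r ≠ 0`. -/
theorem BarycentricGraph.exists_eq_cone {t : FacePoset C → ℝ} {x : X}
    (h : BarycentricGraph φ t x) :
    ∃ (n : ℕ) (i : RelCWComplex.cell C n) (r : ℝ) (u : FacePoset C → ℝ) (y : Fin n → ℝ),
      r ∈ Ico (0 : ℝ) 1 ∧ (∀ ρ, u ρ ≠ 0 → ρ < face i) ∧
      t = r • u + (1 - r) • vertexCoord (face i) ∧ x = φ n i (r • y) ∧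
      (r ≠ 0 → y ∈ sphere 0 1 ∧ BarycentricGraph φ u (φ n i y)) := by
  cases h with
  | @vertex n i => exact ⟨n, i, 0, 0, 0, by simp, by simp, by simp, by simp, by simp⟩
  | @cone n i u y r h hu hy hr =>
    exact ⟨n, i, r, u, y, Ioo_subset_Ico_self hr, hu, rfl, rfl, fun _ => ⟨hy, h⟩⟩

theorem BarycentricGraph.cone_of_mem_Icc {n : ℕ} (i : RelCWComplex.cell C n)
    {u : FacePoset C → ℝ} {y : Fin n → ℝ} {r : ℝ} (h : BarycentricGraph φ u (φ n i y))
    (hu : ∀ ρ, u ρ ≠ 0 → ρ < face i) (hy : y ∈ sphere 0 1) (hr : r ∈ Icc (0 : ℝ) 1) :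
    BarycentricGraph φ (r • u + (1 - r) • vertexCoord (face i)) (φ n i (r • y)) := by
  rcases hr.1.eq_or_lt with rfl | h0
  · simpa using BarycentricGraph.vertex i
  rcases hr.2.eq_or_lt with rfl | h1
  · simpa using h
  exact .cone i h hu hy ⟨h0, h1⟩

theorem smul_mem_openCell (hφ : ∀ (n : ℕ) (i : RelCWComplex.cell C n), IsCellChart i (φ n i))
    {n : ℕ} {i : RelCWComplex.cell C n} {y : Fin n → ℝ} {r : ℝ} (hr : r ∈ Ico (0 : ℝ) 1)
    (hy : r ≠ 0 → y ∈ sphere 0 1) : φ n i (r • y) ∈ RelCWComplex.openCell n i := by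
  by_cases h : r = 0
  · rw [h, zero_smul]
    exact (hφ n i).apply_zero_mem
  · exact (hφ n i).apply_smul_mem (hy h) hr

/-- The link between both sides: the open cell carrying `x` is the top of the support of `t`. -/
theorem BarycentricGraph.exists_cell
    (hφ : ∀ (n : ℕ) (i : RelCWComplex.cell C n), IsCellChart i (φ n i))
    {t : FacePoset C → ℝ} {x : X} (h : BarycentricGraph φ t x) :
    ∃ (n : ℕ) (i : RelCWComplex.cell C n), x ∈ RelCWComplex.openCell n i ∧ t (face i) ≠ 0 ∧
      ∀ ρ, t ρ ≠ 0 → ρ ≤ face i := by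
  obtain ⟨n, i, r, u, y, hr, hu, rfl, rfl, hy⟩ := h.exists_eq_cone
  refine ⟨n, i, smul_mem_openCell hφ hr fun h => (hy h).1, ?_, le_of_cone_apply_ne_zero hu r⟩
  rw [cone_apply_self hu]
  exact (sub_pos.2 hr.2).ne'

theorem BarycentricGraph.le_face_of_mem_openCell
    (hφ : ∀ (n : ℕ) (i : RelCWComplex.cell C n), IsCellChart i (φ n i))
    {t : FacePoset C → ℝ} {x : X} (h : BarycentricGraph φ t x) {n : ℕ}
    {i : RelCWComplex.cell C n} (hx : x ∈ RelCWComplex.openCell n i) :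
    ∀ ρ, t ρ ≠ 0 → ρ ≤ face i := by
  obtain ⟨m, j, hj, -, hle⟩ := h.exists_cell hφ
  cases cell_eq_of_mem_openCell hx hj
  exact hle

theorem BarycentricGraph.mem_realization [RelCWComplex.Finite C] {t : FacePoset C → ℝ} {x : X}
    (h : BarycentricGraph φ t x) : t ∈ realization (orderComplex (FacePoset C)) := by
  induction h with
  | vertex i => exact vertex_mem_realization (face i)
  | cone i _ hu _ hr ih => exact cone_mem_realization ih hu (Ioo_subset_Icc_self hr)

theorem BarycentricGraph.mem_complex
    (hφ : ∀ (n : ℕ) (i : RelCWComplex.cell C n), IsCellChart i (φ n i))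
    {t : FacePoset C → ℝ} {x : X} (h : BarycentricGraph φ t x) : x ∈ C := by
  obtain ⟨n, i, hx, -⟩ := h.exists_cell hφ
  exact RelCWComplex.openCell_subset_complex n i hx

theorem exists_mem_sphere_of_mem_cellFrontier
    (hφ : ∀ (n : ℕ) (i : RelCWComplex.cell C n), IsCellChart i (φ n i)) {n : ℕ}
    {i : RelCWComplex.cell C n} {x : X} (hx : x ∈ RelCWComplex.cellFrontier n i) :
    ∃ y ∈ sphere (0 : Fin n → ℝ) 1, φ n i y = x := by
  rwa [← (hφ n i).image_sphere] at hx

theorem BarycentricGraph.left_unique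
    (hφ : ∀ (n : ℕ) (i : RelCWComplex.cell C n), IsCellChart i (φ n i))
    {t t' : FacePoset C → ℝ} {x : X} (h : BarycentricGraph φ t x) (h' : BarycentricGraph φ t' x) :
    t = t' := by
  classical
  induction h generalizing t' with
  | @vertex n i =>
    obtain ⟨n', i', r', u', y', hr', hu', rfl, hx, hy'⟩ := h'.exists_eq_cone
    cases cell_eq_of_mem_openCell (hφ n i).apply_zero_mem
      (hx ▸ smul_mem_openCell hφ hr' fun h => (hy' h).1)
    by_cases h0 : r' = 0
    · simp [h0]
    have hs := (hy' h0).1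
    have hn := norm_smul_of_mem_sphere hs hr'.1
    -- Injectivity of the chart makes the centre equal to `r' • y'`, whose norm is `r'`.
    rw [← (hφ n i).injOn (by simp) (mem_closedBall_zero_iff.2 (hn.trans_le hr'.2.le)) hx,
      norm_zero] at hn
    exact (h0 hn.symm).elim
  | @cone n i u y r h hu hy hr ih =>
    obtain ⟨n', i', r', u', y', hr', hu', rfl, hx, hy'⟩ := h'.exists_eq_cone
    cases cell_eq_of_mem_openCell ((hφ n i).apply_smul_mem hy (Ioo_subset_Ico_self hr))
      (hx ▸ smul_mem_openCell hφ hr' fun h => (hy' h).1)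
    have hn := norm_smul_of_mem_sphere hy hr.1.le
    have hle : ‖r' • y'‖ ≤ 1 := by
      by_cases h0 : r' = 0
      · simp [h0]
      · exact (norm_smul_of_mem_sphere (hy' h0).1 hr'.1).trans_le hr'.2.le
    have he := (hφ n i).injOn (mem_closedBall_zero_iff.2 (hn.trans_le hr.2.le))
      (mem_closedBall_zero_iff.2 hle) hx
    have h0 : r' ≠ 0 := by
      rintro rfl
      rw [he, zero_smul, norm_zero] at hn
      exact hr.1.ne hn
    obtain ⟨hs', hu''⟩ := hy' h0
    -- Polar coordinates in the ball are unique away from the centre: first compare norms, then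
    -- directions.
    obtain rfl : r = r' := by rw [← hn, he, norm_smul_of_mem_sphere hs' hr'.1]
    obtain rfl := smul_right_injective _ h0 he
    rw [ih hu'']

variable [T2Space X] (hC : IsRegularCW C)
  (hφ : ∀ (n : ℕ) (i : RelCWComplex.cell C n), IsCellChart i (φ n i))

include hC hφ

theorem BarycentricGraph.mem_cellFrontier {u : FacePoset C → ℝ} {x : X}
    (h : BarycentricGraph φ u x) {n : ℕ} {i : RelCWComplex.cell C n}
    (hu : ∀ ρ, u ρ ≠ 0 → ρ < face i) : x ∈ RelCWComplex.cellFrontier n i := by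
  obtain ⟨m, j, hx, hj, -⟩ := h.exists_cell hφ
  exact closedCell_subset_cellFrontier_of_lt hC (hu _ hj)
    (RelCWComplex.openCell_subset_closedCell m j hx)

/-- Induction on the top of the support: the point matched with the base `u` lies in the frontier of
the top cell, so it is `φ y` for some `y` on the sphere. -/
theorem BarycentricGraph.exists_right [RelCWComplex.Finite C] {t : FacePoset C → ℝ}
    (ht : t ∈ realization (orderComplex (FacePoset C))) : ∃ x, BarycentricGraph φ t x := by
  obtain ⟨σ, hσ, hσt⟩ := exists_top ht
  induction σ using WellFoundedLT.induction generalizing t with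
  | _ σ ih =>
  obtain ⟨_, n, i, rfl⟩ := σ
  change t (face i) ≠ 0 at hσ
  rcases eq_vertex_or_exists_cone ht hσ with rfl | ⟨r, hr, u, hu, hut, rfl⟩
  · exact ⟨_, .vertex i⟩
  · have hlt : ∀ ρ, u ρ ≠ 0 → ρ < face i := fun ρ hρ =>
      lt_of_le_of_ne (hσt ρ (hut ρ hρ).1) (hut ρ hρ).2
    obtain ⟨τ, hτ, hτt⟩ := exists_top hu
    obtain ⟨x, hx⟩ := ih τ (hlt τ hτ) hu hτ hτt
    obtain ⟨y, hy, rfl⟩ :=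
      exists_mem_sphere_of_mem_cellFrontier hφ (hx.mem_cellFrontier hC hφ hlt)
    exact ⟨_, .cone i hx hlt hy hr⟩

/-- Induction on the cell carrying `x`: radial projection from the barycentre moves `x` to the
frontier, hence into a smaller open cell. -/
theorem BarycentricGraph.exists_left [RelCWComplex.Finite C] {x : X} (hx : x ∈ C) :
    ∃ t, BarycentricGraph φ t x := by
  obtain ⟨n, i, hi⟩ := exists_mem_openCell hx
  generalize hσ : (face i : FacePoset C) = σ
  induction σ using WellFoundedLT.induction generalizing x n with
  | _ σ ih =>
  subst hσ
  rw [← (hφ n i).image_ball] at hi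
  obtain ⟨z, hz, rfl⟩ := hi
  rw [mem_ball_zero_iff] at hz
  by_cases h0 : z = 0
  · subst h0
    exact ⟨_, .vertex i⟩
  · have hpos : 0 < ‖z‖ := norm_pos_iff.2 h0
    have hy : ‖z‖⁻¹ • z ∈ sphere (0 : Fin n → ℝ) 1 := by
      rw [mem_sphere_zero_iff_norm, norm_smul, norm_inv, norm_norm, inv_mul_cancel₀ hpos.ne']
    have hfr : φ n i (‖z‖⁻¹ • z) ∈ RelCWComplex.cellFrontier n i :=
      (hφ n i).image_sphere ▸ mem_image_of_mem _ hy
    have hxC := RelCWComplex.cellFrontier_subset_complex n i hfr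
    obtain ⟨m, j, hj⟩ := exists_mem_openCell hxC
    have hlt := face_lt_face hC hj hfr
    obtain ⟨u, hu⟩ := ih _ hlt hxC m j hj rfl
    have := BarycentricGraph.cone i hu
      (fun ρ hρ => (hu.le_face_of_mem_openCell hφ hj ρ hρ).trans_lt hlt) hy ⟨hpos, hz⟩
    rw [smul_inv_smul₀ hpos.ne'] at this
    exact ⟨_, this⟩

theorem BarycentricGraph.right_unique {t : FacePoset C → ℝ} {x x' : X}
    (h : BarycentricGraph φ t x) (h' : BarycentricGraph φ t x') : x = x' := by
  classical
  induction h generalizing x' with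
  | @vertex n i =>
    obtain ⟨n', i', r', u', y', hr', hu', ht, rfl, hy'⟩ := h'.exists_eq_cone
    obtain ⟨hi, rfl, -⟩ := cone_injective (u := 0) (r := 0) (p := (face i : FacePoset C))
      (by simp) hu' one_pos hr'.2 (by rw [← ht]; simp)
    cases face_injective hC hi
    rw [zero_smul]
  | @cone n i u y r h hu hy hr ih =>
    obtain ⟨n', i', r', u', y', hr', hu', ht, rfl, hy'⟩ := h'.exists_eq_cone
    obtain ⟨hi, rfl, huu⟩ := cone_injective hu hu' hr.2 hr'.2 ht
    cases face_injective hC hi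
    obtain rfl := smul_right_injective _ hr.1.ne' huu
    obtain ⟨hy', hx'⟩ := hy' hr.1.ne'
    rw [(hφ n i).injOn (sphere_subset_closedBall hy) (sphere_subset_closedBall hy') (ih hx')]

/-- The graph up to `σ` consists of the graphs up to smaller faces, the pair of vertex and
barycentre, and the cones over the former. Compactness passes through finite unions and continuous
images. -/
theorem isCompact_barycentricGraph_le [RelCWComplex.Finite C] (σ : FacePoset C) :
    IsCompact {q : (FacePoset C → ℝ) × X |
      BarycentricGraph φ q.1 q.2 ∧ ∀ ρ, q.1 ρ ≠ 0 → ρ ≤ σ} := by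
  classical
  induction σ using WellFoundedLT.induction with
  | _ σ ih =>
  obtain ⟨_, n, i, rfl⟩ := σ
  change IsCompact {q : (FacePoset C → ℝ) × X |
      BarycentricGraph φ q.1 q.2 ∧ ∀ ρ, q.1 ρ ≠ 0 → ρ ≤ face i}
  let B : Set ((FacePoset C → ℝ) × X) := ⋃ τ ∈ Iio (face i), {q : (FacePoset C → ℝ) × X |
      BarycentricGraph φ q.1 q.2 ∧ ∀ ρ, q.1 ρ ≠ 0 → ρ ≤ τ}
  have hB : IsCompact B := (toFinite _).isCompact_biUnion fun τ hτ => ih τ hτ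
  have hB' : ∀ {q}, q ∈ B → BarycentricGraph φ q.1 q.2 ∧ ∀ ρ, q.1 ρ ≠ 0 → ρ < face i := by
    intro q hq
    obtain ⟨τ, hτ, h, hle⟩ := mem_iUnion₂.1 hq
    exact ⟨h, fun ρ hρ => (hle ρ hρ).trans_lt hτ⟩
  have hmemB : ∀ {t x} {τ : FacePoset C}, τ < face i → BarycentricGraph φ t x →
      (∀ ρ, t ρ ≠ 0 → ρ ≤ τ) → (t, x) ∈ B := fun hτ h hle => mem_biUnion hτ ⟨h, hle⟩
  -- Keeping `y` itself as a parameter makes the cone map `g` continuous without inverting the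
  -- chart.
  let S : Set ((FacePoset C → ℝ) × (Fin n → ℝ)) :=
    (univ ×ˢ sphere 0 1) ∩ (fun q => (q.1, φ n i q.2)) ⁻¹' B
  have hS : IsCompact S := by
    refine ((hB.image continuous_fst).prod (isCompact_sphere (0 : Fin n → ℝ) 1)).of_isClosed_subset
      (ContinuousOn.preimage_isClosed_of_isClosed ?_ (isClosed_univ.prod isClosed_sphere)
        hB.isClosed) ?_
    · exact continuousOn_fst.prodMk (((hφ n i).continuousOn.mono sphere_subset_closedBall).comp
        continuousOn_snd fun q hq => hq.2)
    · exact fun q hq => ⟨⟨_, hq.2, rfl⟩, hq.1.2⟩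
  let g : ℝ × ((FacePoset C → ℝ) × (Fin n → ℝ)) → (FacePoset C → ℝ) × X := fun q =>
    (q.1 • q.2.1 + (1 - q.1) • vertexCoord (face i), φ n i (q.1 • q.2.2))
  have hg : ContinuousOn g (Icc (0 : ℝ) 1 ×ˢ S) := by
    refine ContinuousOn.prodMk (by fun_prop) ((hφ n i).continuousOn.comp (by fun_prop) ?_)
    rintro ⟨r, u, y⟩ ⟨hr, hq⟩
    exact mem_closedBall_zero_iff.2 ((norm_smul_of_mem_sphere hq.1.2 hr.1).trans_le hr.2)
  convert hB.union (isCompact_singleton.union ((isCompact_Icc.prod hS).image_of_continuousOn hg))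
    using 1
  -- The point of the singleton is still to be supplied. It is listed separately because for `n = 0`
  -- the unit sphere, and with it `S`, is empty.
  swap
  · exact (vertexCoord (face i), φ n i 0)
  ext ⟨t, x⟩
  constructor
  · rintro ⟨h, hle⟩
    obtain ⟨m, j, r, u, y, hr, hu, rfl, rfl, hy⟩ := h.exists_eq_cone
    have hj : (face j : FacePoset C) ≤ face i :=
      hle _ ((cone_apply_self hu r).trans_ne (sub_pos.2 hr.2).ne')
    rcases hj.lt_or_eq with hj | hj
    · exact Or.inl (hmemB hj h (le_of_cone_apply_ne_zero hu r))
    cases face_injective hC hj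
    by_cases h0 : r = 0
    · subst h0
      exact Or.inr (Or.inl (by simp))
    obtain ⟨hy, hu'⟩ := hy h0
    obtain ⟨τ, hτ, hτt⟩ := exists_top hu'.mem_realization
    exact Or.inr (Or.inr ⟨(r, u, y), ⟨Ico_subset_Icc_self hr, ⟨trivial, hy⟩,
      hmemB (hu τ hτ) hu' hτt⟩, rfl⟩)
  · rintro (h | h | ⟨⟨r, u, y⟩, ⟨hr, ⟨-, hy⟩, hq⟩, h⟩)
    · exact ⟨(hB' h).1, fun ρ hρ => ((hB' h).2 ρ hρ).le⟩
    · cases h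
      refine ⟨.vertex i, fun ρ hρ => ?_⟩
      by_contra hne
      exact hρ (vertexCoord_of_ne fun h => hne h.le)
    · cases h
      obtain ⟨hu, hlt⟩ := hB' hq
      exact ⟨.cone_of_mem_Icc i hu hlt hy hr, le_of_cone_apply_ne_zero hlt r⟩

theorem isCompact_barycentricGraph [RelCWComplex.Finite C] :
    IsCompact {q : (FacePoset C → ℝ) × X | BarycentricGraph φ q.1 q.2} := by
  convert isCompact_iUnion (isCompact_barycentricGraph_le hC hφ)
  ext q
  simp only [mem_iUnion]
  exact ⟨fun h => (exists_top h.mem_realization).imp fun σ hσ => ⟨h, hσ.2⟩, fun ⟨_, h⟩ => h.1⟩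

/-- The barycentric parametrisation of a finite regular CW complex. -/
theorem exists_homeomorph_barycentricGraph [RelCWComplex.Finite C] :
    ∃ Φ : realization (orderComplex (FacePoset C)) ≃ₜ C, ∀ t, BarycentricGraph φ t.1 (Φ t) := by
  let G : Set ((FacePoset C → ℝ) × X) := {q | BarycentricGraph φ q.1 q.2}
  have : CompactSpace G := isCompact_iff_compactSpace.1 (isCompact_barycentricGraph hC hφ)
  let f : G → realization (orderComplex (FacePoset C)) := fun q => ⟨q.1.1, q.2.mem_realization⟩
  let g : G → C := fun q => ⟨q.1.2, BarycentricGraph.mem_complex hφ q.2⟩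
  have hf : Function.Bijective f := by
    refine ⟨?_, fun t => ?_⟩
    · rintro ⟨⟨t, x⟩, h⟩ ⟨⟨t', x'⟩, h'⟩ heq
      obtain rfl : t = t' := congrArg Subtype.val heq
      obtain rfl : x = x' := h.right_unique hC hφ h'
      rfl
    · obtain ⟨x, hx⟩ := BarycentricGraph.exists_right hC hφ t.2
      exact ⟨⟨(t.1, x), hx⟩, rfl⟩
  have hg : Function.Bijective g := by
    refine ⟨?_, fun x => ?_⟩
    · rintro ⟨⟨t, x⟩, h⟩ ⟨⟨t', x'⟩, h'⟩ heq
      obtain rfl : x = x' := congrArg Subtype.val heq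
      obtain rfl : t = t' := h.left_unique hφ h'
      rfl
    · obtain ⟨t, ht⟩ := BarycentricGraph.exists_left hC hφ x.2
      exact ⟨⟨(t, x.1), ht⟩, rfl⟩
  have hfc : Continuous (Equiv.ofBijective f hf) :=
    (continuous_fst.comp continuous_subtype_val).subtype_mk _
  have hgc : Continuous (Equiv.ofBijective g hg) :=
    (continuous_snd.comp continuous_subtype_val).subtype_mk _
  refine ⟨hfc.homeoOfEquivCompactToT2.symm.trans hgc.homeoOfEquivCompactToT2, fun t => ?_⟩
  obtain ⟨q, rfl⟩ := hfc.homeoOfEquivCompactToT2.surjective t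
  rw [Homeomorph.trans_apply, Homeomorph.symm_apply_apply]
  exact q.2

end Graph

/-! ### The barycentric parametrisation -/

theorem eq_vertexCoord_of_mem_closedSimplex_singleton {P : Type*} {p : P} {t : P → ℝ}
    (ht : t ∈ closedSimplex {p}) : t = vertexCoord p := by
  obtain ⟨-, h1, h2⟩ := ht
  ext q
  by_cases hq : q = p
  · subst hq
    simpa using h2
  · rw [h1 q (by simpa using hq), vertexCoord_of_ne hq]

theorem vertexCoord_mem_closedSimplex {P : Type*} [Finite P] {s : Finset P} {p : P} (hp : p ∈ s) :
    vertexCoord p ∈ closedSimplex s := by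
  cases nonempty_fintype P
  refine mem_closedSimplex_iff.2 ⟨vertexCoord_nonneg p, fun q hq => ?_, sum_vertexCoord p⟩
  exact vertexCoord_of_ne fun h => hq (h ▸ hp)

theorem cone_mem_closedSimplex {P : Type*} [Finite P] [DecidableEq P] {s : Finset P} {u : P → ℝ}
    (hu : u ∈ closedSimplex s) (p : P) {r : ℝ} (hr : r ∈ Icc (0 : ℝ) 1) :
    r • u + (1 - r) • vertexCoord p ∈ closedSimplex (insert p s) := by
  cases nonempty_fintype P
  obtain ⟨h0, h1, h2⟩ := mem_closedSimplex_iff.1 hu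
  refine mem_closedSimplex_iff.2 ⟨fun q => ?_, fun q hq => ?_, ?_⟩
  · simpa using add_nonneg (mul_nonneg hr.1 (h0 q))
      (mul_nonneg (sub_nonneg.2 hr.2) (vertexCoord_nonneg p q))
  · rw [Finset.mem_insert, not_or] at hq
    simp [h1 q hq.2, hq.1]
  · simp [Finset.sum_add_distrib, ← Finset.mul_sum, h2]

section OrderComplex

variable {P : Type*} [PartialOrder P] [Finite P]

theorem closedSimplex_subset_realization {s : Finset P} (hs : s ∈ (orderComplex P).faces) :
    closedSimplex s ⊆ realization (orderComplex P) :=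
  subset_biUnion_of_mem (u := fun s : Finset P => closedSimplex s) hs

/-- The endpoints matter: `r = 1` on the face opposite `p`, and `r = 0` at `p`, where any vertex of
the non-empty `s` serves as base. -/
theorem exists_cone_of_mem_closedSimplex [DecidableEq P] {s : Finset P} {p : P}
    (hs : s.Nonempty) (hps : insert p s ∈ (orderComplex P).faces) {t : P → ℝ}
    (ht : t ∈ closedSimplex (insert p s)) :
    ∃ u ∈ closedSimplex s, ∃ r ∈ Icc (0 : ℝ) 1, t = r • u + (1 - r) • vertexCoord p := by
  cases nonempty_fintype P
  obtain ⟨h0, h1, h2⟩ := mem_closedSimplex_iff.1 ht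
  by_cases hp : t p = 0
  · refine ⟨t, mem_closedSimplex_iff.2 ⟨h0, fun q hq => ?_, h2⟩, 1, by simp, by simp⟩
    by_cases hqp : q = p
    · rw [hqp, hp]
    · exact h1 q (by simp [hqp, hq])
  rcases eq_vertex_or_exists_cone (closedSimplex_subset_realization hps ht) hp with
    rfl | ⟨r, hr, u, hu, hut, rfl⟩
  · obtain ⟨q, hq⟩ := hs
    exact ⟨_, vertexCoord_mem_closedSimplex hq, 0, by simp, by simp⟩
  · obtain ⟨hu0, -, hu2⟩ := mem_realization_iff.1 hu
    refine ⟨u, mem_closedSimplex_iff.2 ⟨hu0, fun q hq => ?_, hu2⟩, r,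
      Ioo_subset_Icc_self hr, rfl⟩
    by_contra hne
    obtain ⟨htq, hqp⟩ := hut q hne
    exact htq (h1 q (by simp [hqp, hq]))

end OrderComplex

/-! ### Uniqueness of the parametrisation and comparison with the barycentric subdivision. -/

section Parametrization

variable {X : Type*} [TopologicalSpace X] {C : Set X} [CWComplex C]
  [RelCWComplex.Finite C] {φ : ∀ n : ℕ, RelCWComplex.cell C n → (Fin n → ℝ) → X}

/-- The relation is generated by the rules which `Ψ` obeys, so induction on its derivations
suffices. Uniqueness thus holds already among functions. -/
theorem IsBarycentricParametrization.eq_of_barycentricGraph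
    {Ψ : realization (orderComplex (FacePoset C)) → X} (hΨ : IsBarycentricParametrization φ Ψ)
    {t : FacePoset C → ℝ} {x : X} (h : BarycentricGraph φ t x)
    (ht : t ∈ realization (orderComplex (FacePoset C))) : Ψ ⟨t, ht⟩ = x := by
  induction h with
  | @vertex n i => exact hΨ.map_vertex n i
  | @cone n i u y r h hu hy hr ih =>
    exact hΨ.map_segment n i ⟨u, h.mem_realization⟩ _ hu r (Ioo_subset_Icc_self hr) rfl y hy
      (ih h.mem_realization).symm

variable [T2Space X] (hC : IsRegularCW C)
  (hφ : ∀ (n : ℕ) (i : RelCWComplex.cell C n), IsCellChart i (φ n i))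
  {Φ : realization (orderComplex (FacePoset C)) → X} (hΦ : ∀ t, BarycentricGraph φ t.1 (Φ t))

include hC hφ hΦ

theorem isBarycentricParametrization_of_barycentricGraph : IsBarycentricParametrization φ Φ where
  map_vertex n i := (hΦ _).right_unique hC hφ (.vertex i)
  map_segment n i u t hu r hr ht y hy hyu := by
    refine (hΦ t).right_unique hC hφ ?_
    rw [ht]
    exact .cone_of_mem_Icc i (hyu ▸ hΦ u) hu hy hr

theorem image_subset_cellFrontier {n : ℕ} {i : RelCWComplex.cell C n} {s : Finset (FacePoset C)}
    (hlt : ∀ σ ∈ s, σ < face i) :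
    Φ '' {t | t.1 ∈ closedSimplex s} ⊆ RelCWComplex.cellFrontier n i := by
  rintro _ ⟨u, hu, rfl⟩
  refine (hΦ u).mem_cellFrontier hC hφ fun ρ hρ => hlt ρ ?_
  by_contra h
  exact hρ (hu.2.1 ρ h)

-- Segments towards the vertex `face i` go to radii, so a base point `u` of the simplex corresponds
-- to the `y` on the sphere with `φ n i y = Φ u`.
open Classical in
theorem cellCone_image {n : ℕ} (i : RelCWComplex.cell C n) {s : Finset (FacePoset C)}
    (hs : s ∈ (orderComplex (FacePoset C)).faces)
    (his : insert (face i) s ∈ (orderComplex (FacePoset C)).faces)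
    (hlt : ∀ σ ∈ s, σ < face i) :
    cellCone (φ n i) (Φ '' {t | t.1 ∈ closedSimplex s}) =
      Φ '' {t | t.1 ∈ closedSimplex (insert (face i) s)} := by
  have hΦ' := isBarycentricParametrization_of_barycentricGraph hC hφ hΦ
  have hsupp : ∀ {u : FacePoset C → ℝ}, u ∈ closedSimplex s → ∀ ρ, u ρ ≠ 0 → ρ < face i :=
    fun hu ρ hρ => hlt ρ (by
      by_contra h
      exact hρ (hu.2.1 ρ h))
  ext x
  constructor
  · rintro ⟨y, hy, ⟨u, hu, huy⟩, r, hr, rfl⟩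
    have hmem := cone_mem_closedSimplex hu (face i) hr
    exact ⟨⟨_, closedSimplex_subset_realization his hmem⟩, hmem,
      hΦ'.map_segment n i u _ (hsupp hu) r hr rfl y hy huy.symm⟩
  · rintro ⟨t, ht, rfl⟩
    obtain ⟨u, hu, r, hr, htu⟩ := exists_cone_of_mem_closedSimplex hs.1 his ht
    let u' : realization (orderComplex (FacePoset C)) :=
      ⟨u, closedSimplex_subset_realization hs hu⟩
    obtain ⟨y, hy, hyu⟩ := exists_mem_sphere_of_mem_cellFrontier hφ
      (image_subset_cellFrontier hC hφ hΦ hlt ⟨u', hu, rfl⟩)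
    exact ⟨y, hy, ⟨u', hu, hyu.symm⟩, r, hr,
      hΦ'.map_segment n i u' t (hsupp hu) r hr htu y hy hyu⟩

theorem image_closedSimplex_singleton {n : ℕ} (i : RelCWComplex.cell C n) :
    Φ '' {t | t.1 ∈ closedSimplex {face i}} = {φ n i 0} := by
  have hv : Φ (vertex (face i)) = φ n i 0 :=
    (isBarycentricParametrization_of_barycentricGraph hC hφ hΦ).map_vertex n i
  ext x
  constructor
  · rintro ⟨t, ht, rfl⟩
    obtain rfl : t = vertex (face i) :=
      Subtype.ext (eq_vertexCoord_of_mem_closedSimplex_singleton ht)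
    exact hv
  · rintro rfl
    exact ⟨vertex (face i), vertexCoord_mem_closedSimplex (Finset.mem_singleton_self _), hv⟩

/-- Remove the top of the chain: the rest maps into the frontier of the top cell, and joining with
the barycentre restores the top. -/
theorem isBarycentricSimplex_image {s : Finset (FacePoset C)}
    (hs : s ∈ (orderComplex (FacePoset C)).faces) :
    IsBarycentricSimplex φ ((fun σ => Φ (vertex σ)) '' (s : Set _))
      (Φ '' {t | t.1 ∈ closedSimplex s}) := by
  classical
  induction s using Finset.strongInduction with
  | _ s ih =>
  obtain ⟨p, hp, hpt⟩ := exists_top_of_isChain hs.2 hs.1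
  obtain ⟨_, n, i, rfl⟩ := p
  change face i ∈ s at hp
  have hv : Φ (vertex (face i)) = φ n i 0 :=
    (isBarycentricParametrization_of_barycentricGraph hC hφ hΦ).map_vertex n i
  rcases (s.erase (face i)).eq_empty_or_nonempty with he | hne
  · obtain rfl : s = {face i} := by rw [← Finset.insert_erase hp, he]; rfl
    rw [image_closedSimplex_singleton hC hφ hΦ i, Finset.coe_singleton, image_singleton, hv]
    exact .barycentre i
  · have hs' : s.erase (face i) ∈ (orderComplex (FacePoset C)).faces :=
      ⟨hne, hs.2.mono (Finset.coe_subset.2 (Finset.erase_subset _ _))⟩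
    have hlt : ∀ σ ∈ s.erase (face i), σ < face i := fun σ hσ =>
      lt_of_le_of_ne (hpt σ (Finset.mem_of_mem_erase hσ)) (Finset.ne_of_mem_erase hσ)
    have h := IsBarycentricSimplex.cone i (ih _ (Finset.erase_ssubset hp) hs')
      (image_subset_cellFrontier hC hφ hΦ hlt)
    rw [cellCone_image hC hφ hΦ i hs' (by rwa [Finset.insert_erase hp]) hlt, ← hv,
      ← image_insert_eq (f := fun σ => Φ (vertex σ)), ← Finset.coe_insert,
      Finset.insert_erase hp] at h
    exact h

theorem exists_eq_image_of_isBarycentricSimplex {V τ : Set X} (h : IsBarycentricSimplex φ V τ) :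
    ∃ s ∈ (orderComplex (FacePoset C)).faces,
      V = (fun σ => Φ (vertex σ)) '' (s : Set _) ∧ τ = Φ '' {t | t.1 ∈ closedSimplex s} := by
  classical
  have hv := (isBarycentricParametrization_of_barycentricGraph hC hφ hΦ).map_vertex
  induction h with
  | @barycentre n i =>
    refine ⟨{face i}, (orderComplex (FacePoset C)).singleton_mem _, ?_, ?_⟩
    · rw [Finset.coe_singleton, image_singleton, hv]
    · rw [image_closedSimplex_singleton hC hφ hΦ i]
  | @cone n i V τ _ hτ ih =>
    obtain ⟨s, hs, rfl, rfl⟩ := ih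
    -- The barycentre of each cell in `s` belongs to `τ`, hence to the frontier of `i`; this forces
    -- the cell to be a proper face.
    have hlt : ∀ σ ∈ s, σ < face i := by
      rintro ⟨_, m, j, rfl⟩ hσ
      change face j ∈ s at hσ
      refine face_lt_face hC (hφ m j).apply_zero_mem (hτ ⟨vertex (face j), ?_, hv m j⟩)
      exact vertexCoord_mem_closedSimplex hσ
    have his : insert (face i) s ∈ (orderComplex (FacePoset C)).faces := by
      refine ⟨Finset.insert_nonempty _ _, ?_⟩
      rw [Finset.coe_insert]
      exact hs.2.insert fun σ hσ _ => Or.inr (hlt σ hσ).le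
    refine ⟨insert (face i) s, his, ?_, cellCone_image hC hφ hΦ i hs his hlt⟩
    rw [Finset.coe_insert, image_insert_eq, hv]

/-- Since `Φ t` lies in the open cell of the top of the support of `t`, it belongs to `σ` exactly
when that top is a face of `σ`. -/
theorem image_le_eq (hsurj : ∀ x ∈ C, ∃ t, Φ t = x) (σ : FacePoset C) :
    Φ '' {t | ∀ ρ, t.1 ρ ≠ 0 → ρ ≤ σ} = σ.1 := by
  obtain ⟨_, n, i, rfl⟩ := σ
  ext x
  constructor
  · rintro ⟨t, ht, rfl⟩
    obtain ⟨m, j, hx, hj, -⟩ := (hΦ t).exists_cell hφ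
    exact ht _ hj (RelCWComplex.openCell_subset_closedCell m j hx)
  · intro hx
    have hxC := RelCWComplex.closedCell_subset_complex n i hx
    obtain ⟨t, rfl⟩ := hsurj x hxC
    obtain ⟨m, j, hj⟩ := exists_mem_openCell hxC
    exact ⟨t, fun ρ hρ => ((hΦ t).le_face_of_mem_openCell hφ hj ρ hρ).trans
      (face_le_face hC hj hx), rfl⟩

end Parametrization

end FaceReconstruction

theorem mainTheorem2 :
    -- Finite regular CW complexes.
    (∀ {X : Type*} [TopologicalSpace X] [T2Space X] (C : Set X) [CWComplex C]
      [RelCWComplex.Finite C], IsRegularCW C →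
      -- For any charts of the closed cells there is exactly one barycentric parametrisation
      -- of `C` by the realised order complex, and it is an isomorphism onto the barycentric
      -- subdivision.
      (∀ φ : ∀ n : ℕ, RelCWComplex.cell C n → (Fin n → ℝ) → X,
        (∀ (n : ℕ) (i : RelCWComplex.cell C n), IsCellChart i (φ n i)) →
        ∃ Φ : realization
            (orderComplex (FacePoset C)) ≃ₜ C,
          IsBarycentricParametrization φ (fun t => (Φ t : X)) ∧
          (∀ Ψ : realization
              (orderComplex (FacePoset C)) ≃ₜ C,
            IsBarycentricParametrization φ (fun t => (Ψ t : X)) → Ψ = Φ) ∧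
          -- The simplices of the barycentric subdivision are exactly the images of the chains.
          (∀ V τ : Set X, IsBarycentricSimplex φ V τ ↔
            ∃ s ∈ (orderComplex (FacePoset C)).faces,
              V = (fun σ => (Φ (vertex σ) : X)) '' (s : Set _) ∧
              τ = (fun t => (Φ t : X)) '' {t | t.1 ∈ closedSimplex s}) ∧
          -- Every closed cell is the union of the simplices of the chains of its faces.
          (∀ σ : FacePoset C,
            (fun t => (Φ t : X)) '' {t | ∀ ρ, t.1 ρ ≠ 0 → ρ ≤ σ} = σ.1)) ∧
      Nonempty (realization
        (orderComplex (FacePoset C)) ≃ₜ C)) ∧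
    -- Finite simplicial complexes: the realised order complex of the face poset is the
    -- polyhedron, by the usual barycentric subdivision.
    (∀ {E : Type*} [AddCommGroup E] [Module ℝ E] [TopologicalSpace E] [IsTopologicalAddGroup E]
      [ContinuousSMul ℝ E] [T2Space E] (K : Geometry.SimplicialComplex ℝ E) [Finite K.faces],
      ∃ Φ : realization (orderComplex K.faces) ≃ₜ K.space,
        ∀ t, (Φ t : E) = ∑ᶠ s : K.faces, t.1 s • s.1.centroid ℝ id) ∧
    -- The face poset determines the polyhedron up to homeomorphism.
    (∀ {E : Type*} [AddCommGroup E] [Module ℝ E] [TopologicalSpace E] [IsTopologicalAddGroup E]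
      [ContinuousSMul ℝ E] [T2Space E] (K : Geometry.SimplicialComplex ℝ E) [Finite K.faces]
      {F : Type*} [AddCommGroup F] [Module ℝ F] [TopologicalSpace F] [IsTopologicalAddGroup F]
      [ContinuousSMul ℝ F] [T2Space F] (L : Geometry.SimplicialComplex ℝ F) [Finite L.faces],
      Nonempty (K.faces ≃o L.faces) → Nonempty (K.space ≃ₜ L.space)) := by
  refine ⟨?_, ?_, ?_⟩
  · intro X _ _ C _ _ hC
    refine ⟨fun φ hφ => ?_, ?_⟩
    · obtain ⟨Φ, hΦ⟩ := exists_homeomorph_barycentricGraph hC hφ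
      refine ⟨Φ, isBarycentricParametrization_of_barycentricGraph hC hφ hΦ, fun Ψ hΨ => ?_,
        fun V τ => ⟨exists_eq_image_of_isBarycentricSimplex hC hφ hΦ, ?_⟩,
        image_le_eq hC hφ hΦ fun x hx => ⟨Φ.symm ⟨x, hx⟩, by simp⟩⟩
      · ext t
        exact hΨ.eq_of_barycentricGraph (hΦ t) t.2
      · rintro ⟨s, hs, rfl, rfl⟩
        exact isBarycentricSimplex_image hC hφ hΦ hs
    · choose φ hφ using hC.exists_chart
      obtain ⟨Φ, -⟩ := exists_homeomorph_barycentricGraph hC hφ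
      exact ⟨Φ⟩
  · intro E _ _ _ _ _ _ K _
    exact exists_barycentric_homeomorph K
  · rintro E _ _ _ _ _ _ K _ F _ _ _ _ _ _ L _ ⟨e⟩
    obtain ⟨Φ, -⟩ := exists_barycentric_homeomorph K
    obtain ⟨Ψ, -⟩ := exists_barycentric_homeomorph L
    -- Both polyhedra are realisations of order complexes, which depend only on the posets.
    exact ⟨Φ.symm.trans ((realizationCongr e).trans Ψ)⟩
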